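/- For a Lebesgue measurable set $\Omega\subset\mathbb R^3$ let $P(\Omega)=\sup\{\int_\Omega \operatorname{div}X : X\in C^1_c(\mathbb R^3;\mathbb R^3),\ |X|\le 1\}\in[0,\infty]$ be its perimeter, $D(\Omega)=\frac12\iint_{\Omega\times\Omega}\frac{dx\,dy}{|x-y|}\in[0,\infty]$ its Coulomb energy, $\mathcal E(\Omega)=P(\Omega)+D(\Omega)$, and for $V>0$ let $E(V)=\inf\{\mathcal E(\Omega):\Omega\subset\mathbb R^3\text{ measurable},\ |\Omega|=V\}$. Let $R>0$ with $V=\frac43\pi R^3\le 1$, let $B_R\subset\mathbb R^3$ be the ball of radius $R$ centered at the origin, and suppose that $E(V)=\mathcal E(B_R)$. If $\Omega\subset\mathbb R^3$ is measurable with $|\Omega|=V$ and $\mathcal E(\Omega)=E(V)$, then $\Omega$ is strictly outer-minimizing: every measurable set $\hat\Omega\supset\Omega$ of finite volume with $P(\hat\Omega)\le P(\Omega)$ satisfies $|\hat\Omega\setminus\Omega|=0$. -/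

import Mathlib

open MeasureTheory
open scoped ENNReal

noncomputable section

namespace LiquidDrop

/-- Three-dimensional Euclidean space. -/
abbrev R3 : Type := EuclideanSpace ℝ (Fin 3)

/-- The divergence `∑ i, ∂ᵢ Xᵢ` of a vector field on `ℝ³`. -/
def divergence (X : R3 → R3) (x : R3) : ℝ :=
  ∑ i : Fin 3, (fderiv ℝ X x (EuclideanSpace.single i 1)) i

/-- Admissible test fields: `X ∈ C¹_c(ℝ³; ℝ³)` with `|X| ≤ 1`. -/
def IsTestField (X : R3 → R3) : Prop :=
  ContDiff ℝ 1 X ∧ HasCompactSupport X ∧ ∀ x, ‖X x‖ ≤ 1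

/-- The perimeter `P(Ω) = sup { ∫_Ω div X : X ∈ C¹_c(ℝ³; ℝ³), |X| ≤ 1 } ∈ [0, ∞]`.
The value `0` is attained at `X = 0`, so truncating negative integrals at `0` does not
change the supremum. -/
def perimeter (Ω : Set R3) : ℝ≥0∞ :=
  ⨆ (X : R3 → R3) (_ : IsTestField X), ENNReal.ofReal (∫ x in Ω, divergence X x)

/-- The Coulomb energy `D(Ω) = ½ ∬_{Ω × Ω} dx dy / |x - y| ∈ [0, ∞]`. -/
def coulomb (Ω : Set R3) : ℝ≥0∞ :=
  2⁻¹ * ∫⁻ x in Ω, ∫⁻ y in Ω, ‖x - y‖ₑ⁻¹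

/-- The liquid drop energy `P(Ω) + D(Ω)`. -/
def energy (Ω : Set R3) : ℝ≥0∞ := perimeter Ω + coulomb Ω

/-- The minimal energy at volume `V`: the infimum of the energy over all Lebesgue
measurable sets of volume `V`. (`NullMeasurableSet Ω volume` is Lebesgue measurability.) -/
def minEnergy (V : ℝ) : ℝ≥0∞ :=
  ⨅ (Ω : Set R3) (_ : NullMeasurableSet Ω volume) (_ : volume Ω = ENNReal.ofReal V), energy Ω

/-- A Lebesgue measurable set `Ω` is strictly outer-minimizing if every Lebesgue measurable
superset of finite volume whose perimeter is at most that of `Ω` differs from `Ω` by a null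
set. Finiteness of the volume of the competitor is needed: the whole space has perimeter `0`. -/
def StrictlyOuterMinimizing (Ω : Set R3) : Prop :=
  NullMeasurableSet Ω volume ∧
    ∀ Ω' : Set R3, NullMeasurableSet Ω' volume → Ω ⊆ Ω' → volume Ω' < ∞ →
      perimeter Ω' ≤ perimeter Ω → volume (Ω' \ Ω) = 0

end LiquidDrop

end

namespace LiquidDrop

open Set Metric
open scoped Pointwise

/-! Take a competitor `Ω'` of volume `4/3 π r³` and shrink it by `R / r` back to volume `V`.
Perimeter scales by the square and Coulomb energy by the fifth power, so minimality of `Ω` bounds `P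
+ D` by the rescaled energy (`minEnergy_le_of_subset`). Passing from `Ω` to `Ω'` costs Coulomb
energy at most the added volume times `2πr²`, the maximal potential at volume `4/3 π r³`
(`coulomb_le_add`, `lintegral_inv_enorm_sub_le_of_volume_eq`).

Optimality of the ball enters only through `P + D ≥ P(B_R) ≥ 4πR²`. With `V ≤ 1` and `m = r / R > 1`
these bounds would force `2m(m² - 1) ≤ m³ - 1`, which is false (`radius_le_of_energy_le`). So `r ≤
R`, and nothing was added. -/

lemma finrank_R3 : Module.finrank ℝ R3 = 3 := by simp

/-! ### Bounds on the Newtonian potential -/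

lemma pow_smul_truncated_inv_eq_indicator {r : ℝ} (hr : 0 < r) {y : ℝ} (hy : 0 < y) :
    y ^ (Module.finrank ℝ R3 - 1) • max (1 / y - 1 / r) 0
      = (Ioc 0 r).indicator (fun y => y - y ^ 2 / r) y := by
  rw [finrank_R3]
  by_cases h : y ≤ r
  · have : 1 / r ≤ 1 / y := one_div_le_one_div_of_le hy h
    rw [indicator_of_mem (mem_Ioc.2 ⟨hy, h⟩), max_eq_left (by linarith), smul_eq_mul]
    norm_num
    field_simp
  · have : 1 / y ≤ 1 / r := one_div_le_one_div_of_le hr (not_le.1 h).le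
    rw [indicator_of_notMem (fun H => h H.2), max_eq_right (by linarith), smul_zero]

lemma integrable_truncated_inv_norm {r : ℝ} (hr : 0 < r) :
    Integrable (fun y : R3 => max (1 / ‖y‖ - 1 / r) 0) := by
  rw [integrable_fun_norm_addHaar volume (f := fun s : ℝ => max (1 / s - 1 / r) 0),
    integrableOn_congr_fun (fun y (hy : y ∈ Ioi 0) => pow_smul_truncated_inv_eq_indicator hr hy)
      measurableSet_Ioi]
  apply Integrable.integrableOn
  rw [integrable_indicator_iff measurableSet_Ioc]
  exact (Continuous.integrableOn_Icc (by fun_prop)).mono_set Ioc_subset_Icc_self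

lemma integral_truncated_inv_norm {r : ℝ} (hr : 0 < r) :
    ∫ y : R3, max (1 / ‖y‖ - 1 / r) 0 = 2 / 3 * Real.pi * r ^ 2 := by
  rw [integral_fun_norm_addHaar volume (fun s : ℝ => max (1 / s - 1 / r) 0),
    setIntegral_congr_fun measurableSet_Ioi
      (fun y hy => pow_smul_truncated_inv_eq_indicator hr hy),
    setIntegral_indicator measurableSet_Ioc,
    inter_eq_self_of_subset_right Ioc_subset_Ioi_self,
    ← intervalIntegral.integral_of_le hr.le, intervalIntegral.integral_sub (by simp)
      (Continuous.intervalIntegrable (by fun_prop) _ _), intervalIntegral.integral_div,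
    integral_id, integral_pow, finrank_R3, measureReal_def, EuclideanSpace.volume_ball_fin_three]
  rw [ENNReal.toReal_mul, ENNReal.toReal_pow, ENNReal.toReal_ofReal zero_le_one,
    ENNReal.toReal_ofReal (by positivity)]
  simp only [smul_eq_mul, nsmul_eq_mul]
  push_cast
  field_simp
  ring

/-- Split the kernel as `1/s ≤ 1/r + (1/s - 1/r)₊`: the constant sees only the volume of `A`, and
the truncated part is integrated over all of space. The bound is sharp for the ball of radius `r`
about `x`. -/
lemma lintegral_inv_enorm_sub_le (A : Set R3) (x : R3) {r : ℝ} (hr : 0 < r) :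
    ∫⁻ y in A, ‖x - y‖ₑ⁻¹
      ≤ ENNReal.ofReal (1 / r) * volume A + ENNReal.ofReal (2 / 3 * Real.pi * r ^ 2) := by
  have hpt : ∀ᵐ y ∂(volume.restrict A), ‖x - y‖ₑ⁻¹
      ≤ ENNReal.ofReal (1 / r) + ENNReal.ofReal (max (1 / ‖x - y‖ - 1 / r) 0) := by
    apply ae_restrict_of_ae
    filter_upwards [compl_mem_ae_iff.2 (measure_singleton x)] with y hy
    have hpos : 0 < ‖x - y‖ := norm_pos_iff.2 (sub_ne_zero.2 fun h => hy h.symm)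
    rw [← ENNReal.ofReal_add (by positivity) (le_max_right _ _), ← ofReal_norm,
      ← ENNReal.ofReal_inv_of_pos hpos]
    apply ENNReal.ofReal_le_ofReal
    rw [← one_div]
    linarith [le_max_left (1 / ‖x - y‖ - 1 / r) 0]
  refine (lintegral_mono_ae hpt).trans ?_
  rw [lintegral_add_left measurable_const, setLIntegral_const]
  gcongr
  calc ∫⁻ y in A, ENNReal.ofReal (max (1 / ‖x - y‖ - 1 / r) 0)
      ≤ ∫⁻ y, ENNReal.ofReal (max (1 / ‖x - y‖ - 1 / r) 0) := setLIntegral_le_lintegral _ _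
    _ = ∫⁻ y : R3, ENNReal.ofReal (max (1 / ‖y‖ - 1 / r) 0) :=
      lintegral_sub_left_eq_self (fun y : R3 => ENNReal.ofReal (max (1 / ‖y‖ - 1 / r) 0)) x
    _ = ENNReal.ofReal (2 / 3 * Real.pi * r ^ 2) := by
      rw [← integral_truncated_inv_norm hr, ofReal_integral_eq_lintegral_ofReal
        (integrable_truncated_inv_norm hr) (ae_of_all _ fun _ => le_max_right _ _)]

/-- Among sets of given volume, the Newtonian potential is largest at the centre of a ball. -/
lemma lintegral_inv_enorm_sub_le_of_volume_eq {A : Set R3} (x : R3) {r : ℝ} (hr : 0 < r)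
    (hA : volume A = ENNReal.ofReal (4 / 3 * Real.pi * r ^ 3)) :
    ∫⁻ y in A, ‖x - y‖ₑ⁻¹ ≤ ENNReal.ofReal (2 * Real.pi * r ^ 2) := by
  refine (lintegral_inv_enorm_sub_le A x hr).trans_eq ?_
  rw [hA, ← ENNReal.ofReal_mul (by positivity), ← ENNReal.ofReal_add (by positivity)
    (by positivity)]
  congr 1
  field_simp
  ring

/-! ### Coulomb energy under enlargement -/

lemma measurable_inv_enorm_sub : Measurable fun p : R3 × R3 => ‖p.1 - p.2‖ₑ⁻¹ := by fun_prop

/-- Enlarging a set adds at most the added volume times a bound on the potential. -/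
lemma coulomb_le_add {Ω Ω' : Set R3} (h : Ω ⊆ Ω') {M : ℝ≥0∞}
    (hM : ∀ x, ∫⁻ y in Ω', ‖x - y‖ₑ⁻¹ ≤ M) :
    coulomb Ω' ≤ coulomb Ω + volume (Ω' \ Ω) * M := by
  set A := Ω' \ Ω
  have hU : Ω ∪ A = Ω' := union_sdiff_cancel h
  have hmeas : ∀ S : Set R3, Measurable fun x : R3 => ∫⁻ y in S, ‖x - y‖ₑ⁻¹ := fun S =>
    measurable_inv_enorm_sub.lintegral_prod_right'
  have hA : ∀ f : R3 → ℝ≥0∞, (∀ x, f x ≤ M) → ∫⁻ x in A, f x ≤ volume A * M := fun f hf =>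
    (lintegral_mono hf).trans_eq (by rw [setLIntegral_const, mul_comm])
  -- By symmetry of the kernel the outer variable can be taken in `A`, where the potential of `Ω` is
  -- at most that of `Ω'`.
  have hcross : ∫⁻ x in Ω, ∫⁻ y in A, ‖x - y‖ₑ⁻¹ ≤ volume A * M := by
    rw [lintegral_lintegral_swap measurable_inv_enorm_sub.aemeasurable]
    refine hA _ fun x => ?_
    simp_rw [enorm_sub_rev _ x]
    exact (lintegral_mono_set h).trans (hM x)
  have key : ∫⁻ x in Ω', ∫⁻ y in Ω', ‖x - y‖ₑ⁻¹
      ≤ (∫⁻ x in Ω, ∫⁻ y in Ω, ‖x - y‖ₑ⁻¹) + 2 * (volume A * M) := by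
    calc ∫⁻ x in Ω', ∫⁻ y in Ω', ‖x - y‖ₑ⁻¹
        ≤ (∫⁻ x in Ω, ∫⁻ y in Ω', ‖x - y‖ₑ⁻¹) + ∫⁻ x in A, ∫⁻ y in Ω', ‖x - y‖ₑ⁻¹ := by
          refine le_of_eq_of_le ?_ (lintegral_union_le _ Ω A)
          rw [hU]
      _ ≤ ((∫⁻ x in Ω, ∫⁻ y in Ω, ‖x - y‖ₑ⁻¹) + ∫⁻ x in Ω, ∫⁻ y in A, ‖x - y‖ₑ⁻¹)
          + volume A * M := by
          gcongr
          · rw [← lintegral_add_left (hmeas Ω)]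
            refine lintegral_mono fun x => ?_
            conv_lhs => rw [← hU]
            exact lintegral_union_le _ _ _
          · exact hA _ hM
      _ ≤ _ := by
          rw [two_mul, ← add_assoc]
          gcongr
  unfold coulomb
  calc _ ≤ 2⁻¹ * ((∫⁻ x in Ω, ∫⁻ y in Ω, ‖x - y‖ₑ⁻¹) + 2 * (volume A * M)) := by gcongr
    _ = _ := by
      rw [mul_add, ← mul_assoc 2⁻¹ 2, ENNReal.inv_mul_cancel (by norm_num) (by norm_num), one_mul]

lemma coulomb_le_mul {Ω : Set R3} {M : ℝ≥0∞} (hM : ∀ x, ∫⁻ y in Ω, ‖x - y‖ₑ⁻¹ ≤ M) :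
    coulomb Ω ≤ volume Ω * M := by
  simpa [coulomb] using coulomb_le_add (empty_subset Ω) hM

/-! ### Scaling of the two energies -/

lemma setLIntegral_smul_set {c : ℝ} (hc : 0 < c) (S : Set R3) (f : R3 → ℝ≥0∞) :
    ∫⁻ x in c • S, f x = ENNReal.ofReal (c ^ 3) * ∫⁻ x in S, f (c • x) := by
  let e : R3 ≃ᵐ R3 := (Homeomorph.smul (Units.mk0 c hc.ne')).toMeasurableEquiv
  have he : ⇑e = (c • · : R3 → R3) := rfl
  have hmap : (volume.restrict S).map e
      = ENNReal.ofReal (c ^ 3)⁻¹ • (volume.restrict (c • S) : Measure R3) := by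
    have hpre : S = e ⁻¹' (c • S) := by
      rw [he]; ext y; simp [mem_smul_set_iff_inv_smul_mem₀ hc.ne', smul_smul, hc.ne']
    conv_lhs => rw [hpre]
    rw [← e.restrict_map, he, Measure.map_addHaar_smul volume hc.ne', finrank_R3,
      Measure.restrict_smul, abs_of_pos (by positivity)]
  have h1 : ∫⁻ x in S, f (c • x) = ENNReal.ofReal (c ^ 3)⁻¹ * ∫⁻ x in c • S, f x := by
    rw [← smul_eq_mul, ← lintegral_smul_measure, ← hmap, lintegral_map_equiv]
    rfl
  rw [h1, ← mul_assoc, ← ENNReal.ofReal_mul (by positivity), mul_inv_cancel₀ (by positivity),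
    ENNReal.ofReal_one, one_mul]

lemma coulomb_smul {c : ℝ} (hc : 0 < c) (S : Set R3) :
    coulomb (c • S) = ENNReal.ofReal (c ^ 5) * coulomb S := by
  unfold coulomb
  have hin : ∀ x : R3, ∫⁻ y in c • S, ‖c • x - y‖ₑ⁻¹
      = ENNReal.ofReal (c ^ 2) * ∫⁻ y in S, ‖x - y‖ₑ⁻¹ := by
    intro x
    rw [setLIntegral_smul_set hc]
    have : ∀ y : R3, ‖c • x - c • y‖ₑ⁻¹ = ENNReal.ofReal c⁻¹ * ‖x - y‖ₑ⁻¹ := fun y => by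
      rw [← smul_sub, enorm_smul, ENNReal.mul_inv (by simp [hc.ne']) (by simp),
        Real.enorm_of_nonneg hc.le, ENNReal.ofReal_inv_of_pos hc]
    simp_rw [this]
    rw [lintegral_const_mul _ (by fun_prop), ← mul_assoc, ← ENNReal.ofReal_mul (by positivity)]
    congr 2
    field_simp
  rw [setLIntegral_smul_set hc]
  simp_rw [hin]
  rw [lintegral_const_mul _ (measurable_inv_enorm_sub.lintegral_prod_right' (ν := volume.restrict S)),
    ← mul_assoc (ENNReal.ofReal _), ← ENNReal.ofReal_mul (by positivity), mul_left_comm, ← pow_add]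

lemma IsTestField.comp_smul {X : R3 → R3} (hX : IsTestField X) {c : ℝ} (hc : c ≠ 0) :
    IsTestField fun x => X (c • x) :=
  ⟨hX.1.comp (contDiff_const_smul c), hX.2.1.comp_smul hc, fun _ => hX.2.2 _⟩

lemma divergence_comp_smul {X : R3 → R3} (hX : Differentiable ℝ X) (c : ℝ) (x : R3) :
    divergence (fun x => X (c • x)) x = c * divergence X (c • x) := by
  unfold divergence
  have : fderiv ℝ (fun x => X (c • x)) x = c • fderiv ℝ X (c • x) := by
    have h := ((hX (c • x)).hasFDerivAt.comp x ((hasFDerivAt_id x).const_smul c)).fderiv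
    rw [ContinuousLinearMap.comp_smul, ContinuousLinearMap.comp_id] at h
    exact h
  rw [this, Finset.mul_sum]
  simp

lemma perimeter_smul_le {c : ℝ} (hc : 0 < c) (S : Set R3) :
    perimeter (c • S) ≤ ENNReal.ofReal (c ^ 2) * perimeter S := by
  refine iSup₂_le fun X hX => ?_
  have h := Measure.setIntegral_comp_smul volume (divergence X) S hc.ne'
  rw [finrank_R3, abs_of_pos (by positivity), smul_eq_mul] at h
  have hint : ∫ x in c • S, divergence X x
      = c ^ 2 * ∫ x in S, divergence (fun x => X (c • x)) x := by
    simp_rw [divergence_comp_smul (hX.1.differentiable one_ne_zero)]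
    rw [integral_const_mul, h]
    field_simp
  rw [hint, ENNReal.ofReal_mul (by positivity)]
  gcongr
  exact le_iSup₂_of_le _ (hX.comp_smul hc.ne') le_rfl

/-! ### Lower bound for the perimeter of a ball -/

lemma divergence_const_smul_id (c : ℝ) (x : R3) : divergence (fun x => c • x) x = 3 * c := by
  have : fderiv ℝ (fun x : R3 => c • x) x = c • ContinuousLinearMap.id ℝ R3 :=
    ((hasFDerivAt_id x).const_smul c).fderiv
  simp [divergence, this]

lemma le_perimeter_ball_of_lt {R : ℝ} (hR : 0 < R) {t : ℝ} (ht0 : 0 < t) (ht1 : t < 1) :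
    ENNReal.ofReal (t * (4 * Real.pi * R ^ 2)) ≤ perimeter (ball 0 R) := by
  -- The outer radius `R / t` is where `(t / R) • x` reaches norm one, so the cut-off field stays
  -- admissible.
  let φ : ContDiffBump (0 : R3) := ⟨R, R / t, hR, by rw [lt_div_iff₀ ht0]; nlinarith⟩
  let X : R3 → R3 := fun x => φ x • ((t / R) • x)
  have hX : IsTestField X := by
    refine ⟨φ.contDiff.smul (contDiff_const_smul _), φ.hasCompactSupport.smul_right, fun x => ?_⟩
    by_cases hx : ‖x‖ < R / t
    · rw [norm_smul, norm_smul, Real.norm_of_nonneg φ.nonneg, Real.norm_of_nonneg (by positivity)]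
      refine mul_le_one₀ φ.le_one (by positivity) ?_
      rw [lt_div_iff₀ ht0] at hx
      rw [div_mul_eq_mul_div, div_le_one hR]
      linarith
    · have : φ x = 0 := φ.zero_of_le_dist (by simpa using hx)
      simp [X, this]
  have hdiv : ∀ x ∈ ball (0 : R3) R, divergence X x = 3 * (t / R) := by
    intro x hx
    rw [← divergence_const_smul_id _ x]
    have : X =ᶠ[nhds x] fun x => (t / R) • x := by
      filter_upwards [isOpen_ball.mem_nhds hx] with y hy
      have : φ y = 1 := φ.one_of_mem_closedBall (ball_subset_closedBall hy)
      simp [X, this]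
    simp [divergence, this.fderiv_eq]
  refine le_iSup₂_of_le X hX (le_of_eq ?_)
  rw [setIntegral_congr_fun measurableSet_ball hdiv, setIntegral_const, measureReal_def,
    EuclideanSpace.volume_ball_fin_three, ENNReal.toReal_mul, ENNReal.toReal_pow,
    ENNReal.toReal_ofReal hR.le, ENNReal.toReal_ofReal (by positivity), smul_eq_mul]
  congr 1
  field_simp

lemma le_perimeter_ball {R : ℝ} (hR : 0 < R) :
    ENNReal.ofReal (4 * Real.pi * R ^ 2) ≤ perimeter (ball 0 R) := by
  have hlim : Filter.Tendsto (fun t : ℝ => ENNReal.ofReal (t * (4 * Real.pi * R ^ 2)))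
      (nhdsWithin 1 (Iio 1)) (nhds (ENNReal.ofReal (1 * (4 * Real.pi * R ^ 2)))) :=
    (Continuous.tendsto (ENNReal.continuous_ofReal.comp (by fun_prop)) 1).mono_left nhdsWithin_le_nhds
  rw [one_mul] at hlim
  refine le_of_tendsto hlim ?_
  filter_upwards [Ioo_mem_nhdsLT (zero_lt_one' ℝ)] with t ht
  exact le_perimeter_ball_of_lt hR ht.1 ht.2

/-! ### Finiteness of the minimal energy -/

/-- The closed cube `[0, c]³`. -/
def cube (c : ℝ) : Set R3 := WithLp.ofLp ⁻¹' Icc (0 : Fin 3 → ℝ) fun _ => c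

lemma measurableSet_cube (c : ℝ) : MeasurableSet (cube c) :=
  measurableSet_Icc.preimage (PiLp.volume_preserving_ofLp (Fin 3)).measurable

lemma volume_cube {c : ℝ} (hc : 0 ≤ c) : volume (cube c) = ENNReal.ofReal (c ^ 3) := by
  rw [cube, (PiLp.volume_preserving_ofLp (Fin 3)).measure_preimage
    measurableSet_Icc.nullMeasurableSet, Real.volume_Icc_pi]
  simp [ENNReal.ofReal_pow hc]

/-- The divergence theorem on a box bounds the flux of a test field by the total area of the six
faces. A cube thus serves as the finite-energy competitor, with no upper bound on the perimeter of a
ball needed. -/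
lemma perimeter_cube_lt_top (c : ℝ) (hc : 0 ≤ c) : perimeter (cube c) < ∞ := by
  refine lt_of_le_of_lt (b := ENNReal.ofReal (6 * c ^ 2)) (iSup₂_le fun X hX => ?_)
    ENNReal.ofReal_lt_top
  apply ENNReal.ofReal_le_ofReal
  let L : R3 ≃L[ℝ] (Fin 3 → ℝ) := EuclideanSpace.equiv (Fin 3) ℝ
  let Y : (Fin 3 → ℝ) → (Fin 3 → ℝ) := fun z => L (X (L.symm z))
  let Y' : (Fin 3 → ℝ) → (Fin 3 → ℝ) →L[ℝ] (Fin 3 → ℝ) := fun z =>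
    (L : R3 →L[ℝ] (Fin 3 → ℝ)) ∘L (fderiv ℝ X (L.symm z)) ∘L (L.symm : (Fin 3 → ℝ) →L[ℝ] R3)
  have hY : ∀ z, HasFDerivAt Y (Y' z) z := fun z =>
    L.hasFDerivAt.comp z
      ((hX.1.differentiable one_ne_zero _).hasFDerivAt.comp z L.symm.hasFDerivAt)
  have hdiv : ∀ z, ∑ i, Y' z (Pi.single i 1) i = divergence X (L.symm z) := fun z => rfl
  have hcontX : Continuous (divergence X) := by
    have := hX.1.continuous_fderiv one_ne_zero
    unfold divergence
    fun_prop
  have hbound : ∀ z i, ‖Y z i‖ ≤ 1 := fun z i =>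
    (PiLp.norm_apply_le (X (L.symm z)) i).trans (hX.2.2 _)
  have hle : (0 : Fin 3 → ℝ) ≤ fun _ => c := fun _ => hc
  have key := integral_divergence_of_hasFDerivAt_off_countable (0 : Fin 3 → ℝ) (fun _ => c) hle
    Y Y' ∅ countable_empty (fun z _ => (hY z).continuousAt.continuousWithinAt)
    (fun z _ => hY z)
    (Continuous.integrableOn_Icc (by simp_rw [hdiv]; exact hcontX.comp L.symm.continuous))
  have hcube : ∫ x in cube c, divergence X x
      = ∫ z in Icc (0 : Fin 3 → ℝ) fun _ => c, divergence X (L.symm z) :=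
    (PiLp.volume_preserving_ofLp (Fin 3)).setIntegral_preimage_emb
      (MeasurableEquiv.toLp 2 (Fin 3 → ℝ)).symm.measurableEmbedding
      (fun z => divergence X (L.symm z)) _
  rw [hcube]
  simp_rw [hdiv] at key
  rw [key]
  have hface : ∀ g : (Fin 2 → ℝ) → ℝ, (∀ z, ‖g z‖ ≤ 1) →
      ‖∫ z in Icc (0 : Fin 2 → ℝ) fun _ => c, g z‖ ≤ c ^ 2 := by
    intro g hg
    have hv : volume (Icc (0 : Fin 2 → ℝ) fun _ => c) = ENNReal.ofReal (c ^ 2) := by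
      rw [Real.volume_Icc_pi]; simp [ENNReal.ofReal_pow hc]
    refine (norm_setIntegral_le_of_norm_le_const (C := 1) (by simp [hv]) fun z _ => hg z).trans ?_
    rw [measureReal_def, hv, ENNReal.toReal_ofReal (by positivity), one_mul]
  calc _ ≤ ∑ _i : Fin 3, (c ^ 2 + c ^ 2) := by
        refine Finset.sum_le_sum fun i _ => ?_
        refine (le_abs_self _).trans ((abs_sub _ _).trans (add_le_add ?_ ?_))
        · exact hface _ fun z => hbound _ i
        · exact hface _ fun z => hbound _ i
    _ = 6 * c ^ 2 := by simp; ring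

/-! ### Comparison with the rescaled competitor -/

lemma exists_volume_radius {v : ℝ} (hv : 0 < v) : ∃ r : ℝ, 0 < r ∧ v = 4 / 3 * Real.pi * r ^ 3 := by
  have hq : 0 < 3 * v / (4 * Real.pi) := by positivity
  refine ⟨(3 * v / (4 * Real.pi)) ^ ((3 : ℕ) : ℝ)⁻¹, by positivity, ?_⟩
  rw [Real.rpow_inv_natCast_pow hq.le (by norm_num)]
  field_simp

lemma minEnergy_le {V : ℝ} {S : Set R3} (hS : NullMeasurableSet S volume)
    (hvol : volume S = ENNReal.ofReal V) : minEnergy V ≤ energy S :=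
  iInf_le_of_le S (iInf₂_le hS hvol)

lemma minEnergy_lt_top {V : ℝ} (hV : 0 < V) : minEnergy V < ∞ := by
  obtain ⟨r, hr, hVr⟩ := exists_volume_radius hV
  have hc : 0 ≤ V ^ ((3 : ℕ) : ℝ)⁻¹ := by positivity
  have hvol : volume (cube (V ^ ((3 : ℕ) : ℝ)⁻¹)) = ENNReal.ofReal V := by
    rw [volume_cube hc, Real.rpow_inv_natCast_pow hV.le (by norm_num)]
  refine lt_of_le_of_lt (minEnergy_le (measurableSet_cube _).nullMeasurableSet hvol)
    (ENNReal.add_lt_top.2 ⟨perimeter_cube_lt_top _ hc, ?_⟩)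
  refine (coulomb_le_mul fun x => lintegral_inv_enorm_sub_le_of_volume_eq x hr
    (hvol.trans (by rw [hVr]))).trans_lt ?_
  rw [hvol]
  exact ENNReal.mul_lt_top ENNReal.ofReal_lt_top ENNReal.ofReal_lt_top

/-- Rescaling a larger competitor to volume `V` bounds the minimal energy. -/
lemma minEnergy_le_of_subset {R r : ℝ} (hR : 0 < R) (hr : 0 < r) {Ω Ω' : Set R3} (hsub : Ω ⊆ Ω')
    (hΩ' : NullMeasurableSet Ω' volume)
    (hvol : volume Ω' = ENNReal.ofReal (4 / 3 * Real.pi * r ^ 3))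
    (hP : perimeter Ω' ≤ perimeter Ω) :
    minEnergy (4 / 3 * Real.pi * R ^ 3) ≤ ENNReal.ofReal ((R / r) ^ 2) * perimeter Ω
      + ENNReal.ofReal ((R / r) ^ 5) *
        (coulomb Ω + volume (Ω' \ Ω) * ENNReal.ofReal (2 * Real.pi * r ^ 2)) := by
  have hc : 0 < R / r := by positivity
  have hvol' : volume ((R / r) • Ω') = ENNReal.ofReal (4 / 3 * Real.pi * R ^ 3) := by
    rw [Measure.addHaar_smul_of_nonneg _ hc.le, hvol, finrank_R3,
      ← ENNReal.ofReal_mul (by positivity)]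
    congr 1
    field_simp
  have hPs := (perimeter_smul_le hc Ω').trans (mul_le_mul_right hP _)
  have hDs := coulomb_le_add hsub fun x =>
    lintegral_inv_enorm_sub_le_of_volume_eq x hr hvol
  have hΩs : NullMeasurableSet ((R / r) • Ω') volume :=
    Measure.NullMeasurableSet.const_smul hΩ' _
  have hle := minEnergy_le hΩs hvol'
  rw [energy, coulomb_smul hc] at hle
  exact hle.trans (add_le_add hPs (mul_le_mul_right hDs _))

lemma radius_le_of_energy_le {R r P D : ℝ} (hR : 0 < R) (hr : 0 < r)
    (hV : 4 / 3 * Real.pi * R ^ 3 ≤ 1) (hD : 0 ≤ D) (hlow : 4 * Real.pi * R ^ 2 ≤ P + D)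
    (hE : P + D ≤ (R / r) ^ 2 * P + (R / r) ^ 5 *
      (D + (4 / 3 * Real.pi * r ^ 3 - 4 / 3 * Real.pi * R ^ 3) * (2 * Real.pi * r ^ 2))) :
    r ≤ R := by
  by_contra! hlt
  have hpi := Real.pi_pos
  obtain ⟨m, hm⟩ : ∃ m, m = r / R := ⟨_, rfl⟩
  have hrm : r = m * R := by rw [hm]; field_simp
  have hm1 : 1 < m := by rw [hm]; exact (one_lt_div hR).2 hlt
  have hm0 : 0 < m := by linarith
  have hRr : R / r = m⁻¹ := by rw [hm, inv_div]
  rw [hRr, hrm] at hE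
  obtain ⟨V, hVdef⟩ : ∃ V, V = 4 / 3 * Real.pi * R ^ 3 := ⟨_, rfl⟩
  rw [← hVdef] at hV
  have hE' : m ^ 5 * (P + D) ≤ m ^ 3 * P + D + V * (m ^ 3 - 1) * (2 * Real.pi * R ^ 2 * m ^ 2) := by
    have := mul_le_mul_of_nonneg_left hE (show 0 ≤ m ^ 5 by positivity)
    refine this.trans_eq ?_
    rw [hVdef]
    field_simp
    ring
  have h3 : 1 < m ^ 3 := one_lt_pow₀ hm1 (by norm_num)
  have h53 : m ^ 3 < m ^ 5 := pow_lt_pow_right₀ hm1 (by norm_num)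
  have hD' : D ≤ m ^ 3 * D := le_mul_of_one_le_left hD h3.le
  have hlow' := mul_le_mul_of_nonneg_left hlow (sub_nonneg.2 h53.le)
  have hVb : V * (m ^ 3 - 1) * (2 * Real.pi * R ^ 2 * m ^ 2)
      ≤ 1 * (m ^ 3 - 1) * (2 * Real.pi * R ^ 2 * m ^ 2) := by
    have := sub_nonneg.2 h3.le
    gcongr
  -- `D ≤ m³ D` turns `m³ P + D` into `m³ (P + D)`; the remaining `(m⁵ - m³)(P + D)` is bounded
  -- below by `hlow'`.
  have hfin : 2 * Real.pi * R ^ 2 * m ^ 2 * (2 * m * (m ^ 2 - 1) - (m ^ 3 - 1)) ≤ 0 := by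
    linarith [hE', hD', hlow', hVb]
  have hpos : 0 < 2 * m * (m ^ 2 - 1) - (m ^ 3 - 1) := by
    have : 2 * m * (m ^ 2 - 1) - (m ^ 3 - 1) = (m - 1) * (m ^ 2 + (m - 1)) := by ring
    rw [this]
    have := sub_pos.2 hm1
    positivity
  exact absurd hfin (not_le.2 (by positivity))

end LiquidDrop

theorem proposition3p1 (R V : ℝ) (hR : 0 < R) (hV : V = 4 / 3 * Real.pi * R ^ 3) (hV1 : V ≤ 1)
    (hE : LiquidDrop.minEnergy V = LiquidDrop.energy (Metric.ball (0 : LiquidDrop.R3) R))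
    (Ω : Set LiquidDrop.R3) (hΩ : NullMeasurableSet Ω volume)
    (hvol : volume Ω = ENNReal.ofReal V)
    (hmin : LiquidDrop.energy Ω = LiquidDrop.minEnergy V) :
    LiquidDrop.StrictlyOuterMinimizing Ω := by
  open LiquidDrop in
  refine ⟨hΩ, fun Ω' hΩ' hsub hfin hP => ?_⟩
  have hV0 : 0 < V := by rw [hV]; positivity
  have hVol0 : ENNReal.ofReal V ≤ volume Ω' := hvol ▸ measure_mono hsub
  have hv0 : 0 < (volume Ω').toReal :=
    ENNReal.toReal_pos ((ENNReal.ofReal_pos.2 hV0).trans_le hVol0).ne' hfin.ne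
  obtain ⟨r, hr, hvr⟩ := exists_volume_radius hv0
  have hvol' : volume Ω' = ENNReal.ofReal (4 / 3 * Real.pi * r ^ 3) := by
    rw [← hvr, ENNReal.ofReal_toReal hfin.ne]
  have hdiff : volume (Ω' \ Ω)
      = ENNReal.ofReal (4 / 3 * Real.pi * r ^ 3 - 4 / 3 * Real.pi * R ^ 3) := by
    rw [measure_sdiff hsub hΩ (by simp [hvol]), hvol, hvol', hV,
      ENNReal.ofReal_sub _ (by positivity)]
  have hvle : 4 / 3 * Real.pi * R ^ 3 ≤ 4 / 3 * Real.pi * r ^ 3 := by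
    rwa [hvol', hV, ENNReal.ofReal_le_ofReal_iff (by positivity)] at hVol0
  have hEfin : perimeter Ω + coulomb Ω < ∞ := hmin.trans_lt (minEnergy_lt_top hV0)
  obtain ⟨hPfin, hDfin⟩ := ENNReal.add_lt_top.1 hEfin
  have hlow : ENNReal.ofReal (4 * Real.pi * R ^ 2) ≤ perimeter Ω + coulomb Ω :=
    ((le_perimeter_ball hR).trans le_self_add).trans_eq (hmin.trans hE).symm
  have hup := minEnergy_le_of_subset hR hr hsub hΩ' hvol' hP
  rw [← hV, ← hmin, hdiff] at hup
  unfold energy at hup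
  obtain ⟨P, hP0, hPe⟩ : ∃ P : ℝ, 0 ≤ P ∧ perimeter Ω = ENNReal.ofReal P :=
    ⟨_, ENNReal.toReal_nonneg, (ENNReal.ofReal_toReal hPfin.ne).symm⟩
  obtain ⟨D, hD0, hDe⟩ : ∃ D : ℝ, 0 ≤ D ∧ coulomb Ω = ENNReal.ofReal D :=
    ⟨_, ENNReal.toReal_nonneg, (ENNReal.ofReal_toReal hDfin.ne).symm⟩
  rw [hPe, hDe] at hlow hup
  have hle : r ≤ R := by
    refine radius_le_of_energy_le (P := P) (D := D) hR hr (hV ▸ hV1) hD0 ?_ ?_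
    · rwa [← ENNReal.ofReal_add hP0 hD0, ENNReal.ofReal_le_ofReal_iff (by positivity)] at hlow
    · have hA := sub_nonneg.2 hvle
      rwa [← ENNReal.ofReal_add hP0 hD0, ← ENNReal.ofReal_mul (by positivity),
        ← ENNReal.ofReal_mul hA, ← ENNReal.ofReal_add hD0 (by positivity),
        ← ENNReal.ofReal_mul (by positivity),
        ← ENNReal.ofReal_add (by positivity) (by positivity),
        ENNReal.ofReal_le_ofReal_iff (by positivity)] at hup
  rw [hdiff, ENNReal.ofReal_eq_zero, sub_nonpos]
  gcongr
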